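/- **Theorem C.1.** Let $\mathcal X$ be a measurable space, $y:\mathcal X\to[0,1]$ a measurable labeling function, and $\mathcal H$ a class of measurable functions $h:\mathcal X\to\{0,1\}$ (binary classification). For a distribution $q$ on $\mathcal X$ and $h:\mathcal X\to\mathbb R$ let $\mathcal L_q(h)=\mathbb E_{x\sim q}|h(x)-y(x)|$ ($\ell_1$ loss), and write $h_q^*$ for any minimizer of $\mathcal L_q$ over $\mathcal H$. For $k=1,\dots,K$ let client $k$ have a distribution $p_k$ on $\mathcal X$, with density $p_k(x)$ with respect to a common reference measure, and a sample of $n_k\ge 1$ points drawn i.i.d. from $p_k$, with empirical distribution $\hat p_k$. Put $$\pi_k=\frac{n_k}{\sum_j n_j},\quad p=\sum_k\pi_kp_k,\quad \hat p=\sum_k\pi_k\hat p_k,\quad w_k^*(x)=\frac{\pi_kp_k(x)}{\sum_j\pi_jp_j(x)},$$ and let $\tau_{\mathcal H}(m)=\max_{x_1,\dots,x_m\in\mathcal X}\bigl|\{(h(x_1),\dots,h(x_m)):h\in\mathcal H\}\bigr|$ be the growth function. Assume the usual measurability condition that, for every $k$, every $m$ and every $e\in\mathbb R^m$, the map $(x_1,\dots,x_m)\mapsto\sup_{h\in\mathcal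 H}\bigl|\sum_i e_i|h(x_i)-y(x_i)|\bigr|$ is measurable with respect to the completion of $p_k^{m}$. Let $0<\delta<1$ and $\delta\le K/2$ (the latter is automatic if $K\ge2$). Then, with probability at least $1-\delta$ over the samples, for every choice of the empirical loss minimizers $h_{\hat p_k}^*$ and $h_{\hat p}^*$ in $\mathcal H$, $$\mathcal L_p\Bigl(\sum_{k=1}^K w_k^*\,h_{\hat p_k}^*\Bigr)\le\sum_{k=1}^K\pi_k\left[\mathcal L_{\hat p_k}(h_{\hat p_k}^*)+\frac{4+\sqrt{\log\tau_{\mathcal H}(2n_k)}}{(\delta/K)\sqrt{2n_k}}\right]\le\mathcal L_{\hat p}(h_{\hat p}^*)+\sum_{k=1}^K\pi_k\,\frac{4+\sqrt{\log\tau_{\mathcal H}(2n_k)}}{(\delta/K)\sqrt{2n_k}}.$$ In particular the bounds contain no term measuring the discrepancy between the client distributions. -/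

import Mathlib

open MeasureTheory ProbabilityTheory
open scoped ENNReal

namespace FedEnsemble

noncomputable section

/-- The expected `ℓ1` loss `L_q(h) = E_{x ∼ q} |h x - y x|` of a predictor `h` under the
distribution `q`, for the labeling function `y`. -/
def loss {X : Type*} [MeasurableSpace X] (q : Measure X) (y h : X → ℝ) : ℝ :=
  ∫ x, |h x - y x| ∂q

/-- `h` is an expected loss minimizer on `q` in the class `H`, i.e. `h ∈ argmin_{g ∈ H} L_q(g)`. -/
def IsLossMinimizer {X : Type*} [MeasurableSpace X] (H : Set (X → ℝ)) (y : X → ℝ)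
    (q : Measure X) (h : X → ℝ) : Prop :=
  h ∈ H ∧ ∀ g ∈ H, loss q y h ≤ loss q y g

/-- The distribution with density `ρ` with respect to the reference measure `ν`. -/
def densityMeasure {X : Type*} [MeasurableSpace X] (ν : Measure X) (ρ : X → ℝ) : Measure X :=
  ν.withDensity fun x => ENNReal.ofReal (ρ x)

/-- The empirical distribution of the sample `s`. -/
def empiricalMeasure {X : Type*} [MeasurableSpace X] {m : ℕ} (s : Fin m → X) : Measure X :=
  (m : ℝ≥0∞)⁻¹ • ∑ i, Measure.dirac (s i)

/-- The proportion `π_k = n_k / ∑_j n_j` of the data held by client `k`. -/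
def proportion {K : ℕ} (n : Fin K → ℕ) (k : Fin K) : ℝ :=
  (n k : ℝ) / ∑ j, (n j : ℝ)

/-- The average distribution `∑_k π_k • q_k`. -/
def mixture {X : Type*} [MeasurableSpace X] {K : ℕ} (n : Fin K → ℕ) (q : Fin K → Measure X) :
    Measure X :=
  ∑ k, ENNReal.ofReal (proportion n k) • q k

/-- The weight functions `w_k^*(x) = π_k p_k(x) / ∑_j π_j p_j(x)`, where `ρ k` is the density of
the distribution of client `k`. Where the denominator vanishes (a null set for the average
distribution) the value is `0`. -/
def optimalWeight {X : Type*} {K : ℕ} (n : Fin K → ℕ) (ρ : Fin K → X → ℝ) (k : Fin K) (x : X) : ℝ :=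
  proportion n k * ρ k x / ∑ j, proportion n j * ρ j x

/-- The ensemble `∑_k w_k · h_k` of the predictors `h_k` with weight functions `w_k`. -/
def ensemble {X : Type*} {K : ℕ} (w h : Fin K → X → ℝ) (x : X) : ℝ :=
  ∑ k, w k x * h k x

/-- The growth function: the largest number of distinct restrictions of members of `H` to `m`
points. It is used for classes of `{0, 1}`-valued functions, where it is at most `2 ^ m`. Points
may be repeated: this agrees with the maximum over `m`-element subsets whenever there are any, and
also makes sense when the domain has fewer than `m` points. -/
def growthFunction {X : Type*} (H : Set (X → ℝ)) (m : ℕ) : ℕ :=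
  ⨆ x : Fin m → X, ((fun (h : X → ℝ) (i : Fin m) => h (x i)) '' H).ncard

/-- The class of loss functions `x ↦ |h x - y x|`, `h ∈ H`. -/
def lossClass {X : Type*} (H : Set (X → ℝ)) (y : X → ℝ) : Set (X → ℝ) :=
  (fun (h : X → ℝ) (x : X) => |h x - y x|) '' H

/-- The usual measurability condition of empirical process theory: `F` is a `q`-measurable class if
`(x_1, …, x_m) ↦ sup_{f ∈ F} |∑ i, e_i f(x_i)|` is measurable for the completion of `q ^ m`, for
every `m` and every vector `e`. -/
def IsMeasurableClass {X : Type*} [MeasurableSpace X] (q : Measure X) (F : Set (X → ℝ)) : Prop :=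
  ∀ (m : ℕ) (e : Fin m → ℝ),
    AEMeasurable (fun x : Fin m → X => ⨆ f : F, |∑ i, e i * f.1 (x i)|)
      (Measure.pi fun _ : Fin m => q)

end

end FedEnsemble

open FedEnsemble

/-! The mixture density times `optimalWeight` is `π_k p_k`, so the triangle inequality, applied
pointwise, bounds the loss of the ensemble by the average of the losses `L_{p_k}(h_k)`
(`loss_ensemble_le`). Each client is thus compared only with its own distribution, and no
discrepancy term arises. The second inequality holds because the loss is linear in the distribution
and `h_k` beats `g` on client `k`.

It remains to pass from `L_{p_k}` to the empirical loss uniformly over `H`, with failure probability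
`δ / K` (`exists_loss_deviation_set`), and to take a union bound. This is symmetrization by
exponential moments: Jensen over a ghost sample, random swaps between the two samples, a Hoeffding
bound for each of the at most `τ(2m)` restrictions, then Markov. The resulting tail is exponential,
far below what the `1/δ` rate requires. -/

/-- The sign attached to a Boolean. -/
def boolSign (b : Bool) : ℝ := if b then 1 else -1

/-- The sum over sign patterns factorises over coordinates, and each factor is `2 cosh (c a_i) ≤ 2
exp (c² / 2)`. -/
theorem sum_exp_boolSign_le {m : ℕ} (c : ℝ) (a : Fin m → ℝ) (ha : ∀ i, |a i| ≤ 1) :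
    ∑ σ : Fin m → Bool, Real.exp (c * ∑ i, boolSign (σ i) * a i)
      ≤ 2 ^ m * Real.exp (m * (c ^ 2 / 2)) := by
  calc ∑ σ : Fin m → Bool, Real.exp (c * ∑ i, boolSign (σ i) * a i)
      = ∑ σ : Fin m → Bool, ∏ i, Real.exp (c * (boolSign (σ i) * a i)) := by
        simp_rw [Finset.mul_sum, Real.exp_sum]
    _ = ∏ i, ∑ b : Bool, Real.exp (c * (boolSign b * a i)) :=
        (Fintype.prod_sum fun i b => Real.exp (c * (boolSign b * a i))).symm
    _ ≤ ∏ _i : Fin m, (2 * Real.exp (c ^ 2 / 2)) := by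
        refine Finset.prod_le_prod (fun i _ => Finset.sum_nonneg fun b _ => (Real.exp_pos _).le) ?_
        intro i _
        have h1 : ∑ b : Bool, Real.exp (c * (boolSign b * a i)) = 2 * Real.cosh (c * a i) := by
          rw [Real.cosh_eq]
          simp [boolSign]
          ring
        rw [h1]
        have h2 : (c * a i) ^ 2 ≤ c ^ 2 := by
          rw [mul_pow]
          have : a i ^ 2 ≤ 1 := by rw [sq_le_one_iff_abs_le_one]; exact ha i
          nlinarith [sq_nonneg c]
        have h3 := Real.cosh_le_exp_half_sq (c * a i)
        have h4 : Real.exp ((c * a i) ^ 2 / 2) ≤ Real.exp (c ^ 2 / 2) := by gcongr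
        linarith
    _ = 2 ^ m * Real.exp (m * (c ^ 2 / 2)) := by
        rw [Finset.prod_const, mul_pow, ← Real.exp_nat_mul]
        simp

/-! ### Symmetrization and the exponential moment of the supremum. -/

section Symmetrization

variable {X : Type*}

/-- The supremum over the class `F` of the signed sum of differences over the pairs `z i`. -/
noncomputable def signedSup {m : ℕ} (F : Set (X → ℝ)) (σ : Fin m → Bool) (z : Fin m → X × X) : ℝ :=
  ⨆ f : F, |∑ i, boolSign (σ i) * (f.1 (z i).1 - f.1 (z i).2)|

/-- Exchange the two members of the `i`-th pair where `σ i` is false. -/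
def swapPairs {m : ℕ} (σ : Fin m → Bool) (z : Fin m → X × X) : Fin m → X × X :=
  fun i => (if σ i then id else Prod.swap) (z i)

/-- The list of all first members of the pairs, followed by the second members. -/
def unpair {m : ℕ} (z : Fin m → X × X) : Fin (m + m) → X :=
  Fin.append (fun i => (z i).1) (fun i => (z i).2)

theorem unpair_castAdd {m : ℕ} (z : Fin m → X × X) (i : Fin m) :
    unpair z (Fin.castAdd m i) = (z i).1 := Fin.append_left _ _ i

theorem unpair_natAdd {m : ℕ} (z : Fin m → X × X) (i : Fin m) :
    unpair z (Fin.natAdd m i) = (z i).2 := Fin.append_right _ _ i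

/-- Exchanging a pair flips the sign of its difference, so random signs can be traded for random
swaps. -/
theorem signedSup_true_swapPairs {m : ℕ} (F : Set (X → ℝ)) (σ : Fin m → Bool)
    (z : Fin m → X × X) :
    signedSup F (fun _ => true) (swapPairs σ z) = signedSup F σ z := by
  unfold signedSup
  refine iSup_congr fun f => congrArg abs (Finset.sum_congr rfl fun i _ => ?_)
  cases h : σ i <;> simp [boolSign, swapPairs, h]

theorem abs_sub_le_one_of_mem_Icc {F : Set (X → ℝ)} (hF : ∀ f ∈ F, ∀ x, f x ∈ Set.Icc (0 : ℝ) 1)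
    {f : X → ℝ} (hf : f ∈ F) (a b : X) : |f a - f b| ≤ 1 := by
  have h1 := hF f hf a
  have h2 := hF f hf b
  rw [abs_le]
  constructor <;> linarith [h1.1, h1.2, h2.1, h2.2]

theorem abs_signed_sum_le {m : ℕ} {F : Set (X → ℝ)}
    (hF : ∀ f ∈ F, ∀ x, f x ∈ Set.Icc (0 : ℝ) 1) (σ : Fin m → Bool) (z : Fin m → X × X)
    {f : X → ℝ} (hf : f ∈ F) :
    |∑ i, boolSign (σ i) * (f (z i).1 - f (z i).2)| ≤ m := by
  refine (Finset.abs_sum_le_sum_abs _ _).trans ?_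
  calc _ ≤ ∑ _i : Fin m, (1 : ℝ) := by
        refine Finset.sum_le_sum fun i _ => ?_
        have h := abs_sub_le_one_of_mem_Icc hF hf (z i).1 (z i).2
        rw [abs_mul]
        have : |boolSign (σ i)| = 1 := by cases σ i <;> simp [boolSign]
        rw [this, one_mul]
        exact h
    _ = m := by simp

theorem le_signedSup {m : ℕ} {F : Set (X → ℝ)}
    (hF : ∀ f ∈ F, ∀ x, f x ∈ Set.Icc (0 : ℝ) 1) (σ : Fin m → Bool) (z : Fin m → X × X)
    {f : X → ℝ} (hf : f ∈ F) :
    |∑ i, boolSign (σ i) * (f (z i).1 - f (z i).2)| ≤ signedSup F σ z := by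
  refine le_ciSup (f := fun f : F => |∑ i, boolSign (σ i) * (f.1 (z i).1 - f.1 (z i).2)|) ?_ ⟨f, hf⟩
  refine ⟨m, ?_⟩
  rintro _ ⟨g, rfl⟩
  exact abs_signed_sum_le hF σ z g.2

/-- The restrictions of the members of `F` to the points `x`. -/
def restrictions {m : ℕ} (F : Set (X → ℝ)) (x : Fin m → X) : Set (Fin m → ℝ) :=
  (fun (f : X → ℝ) (i : Fin m) => f (x i)) '' F

/-- The supremum sees `f` only through its restriction to the `2m` points, so it is a maximum over a
finite set; the two exponentials account for the absolute value. -/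
theorem exp_signedSup_le {m : ℕ} {F : Set (X → ℝ)} (hFne : F.Nonempty)
    (σ : Fin m → Bool) (z : Fin m → X × X) (hfin : (restrictions F (unpair z)).Finite) {c : ℝ} :
    Real.exp (c * signedSup F σ z) ≤ ∑ v ∈ hfin.toFinset,
      (Real.exp (c * ∑ i, boolSign (σ i) * (v (Fin.castAdd m i) - v (Fin.natAdd m i))) +
        Real.exp (-c * ∑ i, boolSign (σ i) * (v (Fin.castAdd m i) - v (Fin.natAdd m i)))) := by
  let φ : (Fin (m + m) → ℝ) → ℝ := fun v =>
    |∑ i, boolSign (σ i) * (v (Fin.castAdd m i) - v (Fin.natAdd m i))|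
  have hφ (f : X → ℝ) : φ (fun i => f (unpair z i)) =
      |∑ i, boolSign (σ i) * (f (z i).1 - f (z i).2)| := by
    simp only [φ, unpair_castAdd, unpair_natAdd]
  have : Nonempty F := hFne.to_subtype
  have hr : (Set.range fun f : F =>
      |∑ i, boolSign (σ i) * (f.1 (z i).1 - f.1 (z i).2)|).Finite := by
    refine (hfin.image φ).subset ?_
    rintro _ ⟨f, rfl⟩
    exact ⟨_, ⟨f.1, f.2, rfl⟩, hφ f.1⟩
  -- A finite nonempty range contains its supremum: `f` attains `signedSup`.
  obtain ⟨f, hf⟩ := (Set.range_nonempty _).csSup_mem hr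
  have hf' : signedSup F σ z = |∑ i, boolSign (σ i) * (f.1 (z i).1 - f.1 (z i).2)| := hf.symm
  have hmem : (fun i => f.1 (unpair z i)) ∈ hfin.toFinset := by
    rw [Set.Finite.mem_toFinset]
    exact ⟨f.1, f.2, rfl⟩
  refine le_trans ?_ (Finset.single_le_sum (f := fun v : Fin (m + m) → ℝ =>
      (Real.exp (c * ∑ i, boolSign (σ i) * (v (Fin.castAdd m i) - v (Fin.natAdd m i))) +
        Real.exp (-c * ∑ i, boolSign (σ i) * (v (Fin.castAdd m i) - v (Fin.natAdd m i)))))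
      (fun v _ => (add_pos (Real.exp_pos _) (Real.exp_pos _)).le) hmem)
  have hs : ∑ i, boolSign (σ i) * (f.1 (unpair z (Fin.castAdd m i)) -
      f.1 (unpair z (Fin.natAdd m i))) = ∑ i, boolSign (σ i) * (f.1 (z i).1 - f.1 (z i).2) := by
    simp only [unpair_castAdd, unpair_natAdd]
  simp only [hs, hf']
  set S := ∑ i, boolSign (σ i) * (f.1 (z i).1 - f.1 (z i).2)
  rcases abs_choice S with h | h <;> rw [h]
  · linarith [Real.exp_pos (-c * S)]
  · rw [mul_neg, ← neg_mul]
    linarith [Real.exp_pos (c * S)]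

theorem sum_exp_signedSup_le {m N : ℕ} {F : Set (X → ℝ)} (hFne : F.Nonempty)
    (hF : ∀ f ∈ F, ∀ x, f x ∈ Set.Icc (0 : ℝ) 1)
    (hfin : ∀ x : Fin (m + m) → X, (restrictions F x).Finite)
    (hN : ∀ x : Fin (m + m) → X, (restrictions F x).ncard ≤ N) (z : Fin m → X × X) (c : ℝ) :
    ∑ σ : Fin m → Bool, Real.exp (c * signedSup F σ z)
      ≤ 2 ^ m * (2 * N * Real.exp (m * (c ^ 2 / 2))) := by
  calc _ ≤ ∑ σ : Fin m → Bool, ∑ v ∈ (hfin (unpair z)).toFinset,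
      (Real.exp (c * ∑ i, boolSign (σ i) * (v (Fin.castAdd m i) - v (Fin.natAdd m i))) +
        Real.exp (-c * ∑ i, boolSign (σ i) * (v (Fin.castAdd m i) - v (Fin.natAdd m i)))) :=
        Finset.sum_le_sum fun σ _ => exp_signedSup_le hFne σ z _
    _ ≤ ∑ v ∈ (hfin (unpair z)).toFinset, 2 * (2 ^ m * Real.exp (m * (c ^ 2 / 2))) := by
        rw [Finset.sum_comm]
        refine Finset.sum_le_sum fun v hv => ?_
        rw [Set.Finite.mem_toFinset] at hv
        obtain ⟨f, hf, rfl⟩ := hv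
        rw [Finset.sum_add_distrib]
        have ha : ∀ i, |f (unpair z (Fin.castAdd m i)) - f (unpair z (Fin.natAdd m i))| ≤ 1 :=
          fun i => abs_sub_le_one_of_mem_Icc hF hf _ _
        have h1 := sum_exp_boolSign_le c _ ha
        have h2 := sum_exp_boolSign_le (-c) _ ha
        rw [neg_sq] at h2
        linarith
    _ = (restrictions F (unpair z)).ncard * (2 * (2 ^ m * Real.exp (m * (c ^ 2 / 2)))) := by
        rw [Finset.sum_const, nsmul_eq_mul, Set.ncard_eq_toFinset_card _ (hfin _)]
    _ ≤ N * (2 * (2 ^ m * Real.exp (m * (c ^ 2 / 2)))) := by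
        gcongr
        exact hN _
    _ = _ := by ring

variable [MeasurableSpace X] (q : Measure X) [IsProbabilityMeasure q]

theorem measurePreserving_swapPairs {m : ℕ} (σ : Fin m → Bool) :
    MeasurePreserving (swapPairs (X := X) σ) (Measure.pi fun _ : Fin m => q.prod q)
      (Measure.pi fun _ : Fin m => q.prod q) := by
  refine measurePreserving_pi (fun _ : Fin m => q.prod q) (fun _ => q.prod q)
    (f := fun i => (if σ i then id else Prod.swap : X × X → X × X)) fun i => ?_
  cases h : σ i
  · simpa using Measure.measurePreserving_swap
  · simpa using MeasurePreserving.id _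

theorem measurePreserving_unpair (m : ℕ) :
    MeasurePreserving (unpair (X := X) (m := m)) (Measure.pi fun _ : Fin m => q.prod q)
      (Measure.pi fun _ : Fin (m + m) => q) := by
  have hmeas : Measurable (unpair (X := X) (m := m)) := by
    refine measurable_pi_lambda _ fun j => ?_
    refine Fin.addCases (fun i => ?_) (fun i => ?_) j
    · simp only [unpair, Fin.append_left]; fun_prop
    · simp only [unpair, Fin.append_right]; fun_prop
  refine ⟨hmeas, (Measure.pi_eq fun s hs => ?_).symm⟩
  rw [Measure.map_apply hmeas (MeasurableSet.univ_pi hs)]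
  have hpre : unpair ⁻¹' Set.univ.pi s =
      Set.univ.pi fun i : Fin m => s (Fin.castAdd m i) ×ˢ s (Fin.natAdd m i) := by
    ext z
    simp only [Set.mem_preimage, Set.mem_univ_pi, Set.mem_prod]
    constructor
    · intro h i
      exact ⟨unpair_castAdd z i ▸ h (Fin.castAdd m i), unpair_natAdd z i ▸ h (Fin.natAdd m i)⟩
    · intro h j
      refine Fin.addCases (fun i => ?_) (fun i => ?_) j
      · exact (unpair_castAdd z i).symm ▸ (h i).1
      · exact (unpair_natAdd z i).symm ▸ (h i).2
  rw [hpre, Measure.pi_pi]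
  simp only [Measure.prod_prod]
  rw [Finset.prod_mul_distrib, Fin.prod_univ_add]

/-- The measurability condition is applied at `2m` points with coefficients `σ` on the first half
and `-σ` on the second. -/
theorem aemeasurable_signedSup {F : Set (X → ℝ)} (hFq : IsMeasurableClass q F) {m : ℕ}
    (σ : Fin m → Bool) :
    AEMeasurable (signedSup F σ) (Measure.pi fun _ : Fin m => q.prod q) := by
  have h := (hFq (m + m) (Fin.append (fun i => boolSign (σ i))
    fun i => -boolSign (σ i))).comp_quasiMeasurePreserving
      (measurePreserving_unpair q m).quasiMeasurePreserving
  refine h.congr (ae_of_all _ fun z => ?_)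
  refine iSup_congr fun f => congrArg abs ?_
  rw [Fin.sum_univ_add, ← Finset.sum_add_distrib]
  refine Finset.sum_congr rfl fun i _ => ?_
  rw [unpair_castAdd, unpair_natAdd, Fin.append_left, Fin.append_right]
  ring

/-- Swaps preserve the law of the pairs, so every sign pattern has the same integral; it may be
averaged over all `2 ^ m` patterns, where the pointwise bound applies. -/
theorem lintegral_exp_signedSup_le {m N : ℕ} {F : Set (X → ℝ)} (hFne : F.Nonempty)
    (hF : ∀ f ∈ F, ∀ x, f x ∈ Set.Icc (0 : ℝ) 1)
    (hfin : ∀ x : Fin (m + m) → X, (restrictions F x).Finite)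
    (hN : ∀ x : Fin (m + m) → X, (restrictions F x).ncard ≤ N)
    (hFq : IsMeasurableClass q F) (c : ℝ) :
    ∫⁻ z, ENNReal.ofReal (Real.exp (c * signedSup F (fun _ => true) z))
        ∂(Measure.pi fun _ : Fin m => q.prod q)
      ≤ ENNReal.ofReal (2 * N * Real.exp (m * (c ^ 2 / 2))) := by
  set Q := Measure.pi fun _ : Fin m => q.prod q
  have hmeas (σ : Fin m → Bool) :
      AEMeasurable (fun z => ENNReal.ofReal (Real.exp (c * signedSup F σ z))) Q :=
    (Real.measurable_exp.comp_aemeasurable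
      ((aemeasurable_signedSup q hFq σ).const_mul c)).ennreal_ofReal
  have hswap (σ : Fin m → Bool) :
      ∫⁻ z, ENNReal.ofReal (Real.exp (c * signedSup F σ z)) ∂Q =
        ∫⁻ z, ENNReal.ofReal (Real.exp (c * signedSup F (fun _ => true) z)) ∂Q := by
    have hp : MeasurePreserving (swapPairs σ) Q Q := measurePreserving_swapPairs q σ
    conv_rhs => rw [← hp.map_eq]
    rw [lintegral_map' (by rw [hp.map_eq]; exact hmeas _) hp.measurable.aemeasurable]
    simp_rw [signedSup_true_swapPairs]
  have hsum : (2 : ℝ≥0∞) ^ m *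
      ∫⁻ z, ENNReal.ofReal (Real.exp (c * signedSup F (fun _ => true) z)) ∂Q =
      ∫⁻ z, ∑ σ : Fin m → Bool, ENNReal.ofReal (Real.exp (c * signedSup F σ z)) ∂Q := by
    rw [lintegral_finsetSum' _ fun σ _ => hmeas σ]
    simp [hswap]
  have hle : (2 : ℝ≥0∞) ^ m *
      ∫⁻ z, ENNReal.ofReal (Real.exp (c * signedSup F (fun _ => true) z)) ∂Q ≤
      2 ^ m * ENNReal.ofReal (2 * N * Real.exp (m * (c ^ 2 / 2))) := by
    rw [hsum]
    calc _ ≤ ∫⁻ _z : Fin m → X × X,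
          ENNReal.ofReal (2 ^ m * (2 * N * Real.exp (m * (c ^ 2 / 2)))) ∂Q := by
          refine lintegral_mono fun z => ?_
          rw [← ENNReal.ofReal_sum_of_nonneg fun _ _ => (Real.exp_pos _).le]
          exact ENNReal.ofReal_le_ofReal (sum_exp_signedSup_le hFne hF hfin hN z c)
      _ = _ := by
          rw [lintegral_const, measure_univ, mul_one, ENNReal.ofReal_mul (by positivity),
            ENNReal.ofReal_pow (by norm_num)]
          simp
  exact (ENNReal.mul_le_mul_iff_right (by simp) (by simp)).1 hle

/-- The expectation of `f` is its average over a ghost sample `x'`, and Jensen moves that average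
outside the exponential. The right side no longer depends on `f`. -/
theorem exp_deviation_le_lintegral {m : ℕ} {F : Set (X → ℝ)}
    (hF : ∀ f ∈ F, ∀ x, f x ∈ Set.Icc (0 : ℝ) 1) (hFm : ∀ f ∈ F, Measurable f)
    {c : ℝ} (hc : 0 ≤ c) {f : X → ℝ} (hf : f ∈ F) (x : Fin m → X) :
    ENNReal.ofReal (Real.exp (c * (m * (∫ a, f a ∂q) - ∑ i, f (x i)))) ≤
      ∫⁻ x' : Fin m → X, ENNReal.ofReal
        (Real.exp (c * signedSup F (fun _ => true) fun i => (x i, x' i)))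
        ∂(Measure.pi fun _ : Fin m => q) := by
  have hfm := hFm f hf
  have hfint : Integrable f q := by
    refine Integrable.of_bound hfm.aestronglyMeasurable 1 (ae_of_all _ fun a => ?_)
    rw [Real.norm_eq_abs, abs_le]
    constructor <;> linarith [(hF f hf a).1, (hF f hf a).2]
  let g : (Fin m → X) → ℝ := fun x' => c * (∑ i, f (x' i) - ∑ i, f (x i))
  have hfi (i : Fin m) : Integrable (fun x' : Fin m → X => f (x' i))
      (Measure.pi fun _ : Fin m => q) :=
    (measurePreserving_eval (fun _ : Fin m => q) i).integrable_comp_of_integrable hfint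
  have hfe (i : Fin m) : ∫ x' : Fin m → X, f (x' i) ∂(Measure.pi fun _ : Fin m => q) =
      ∫ a, f a ∂q := by
    have hp := measurePreserving_eval (fun _ : Fin m => q) i
    conv_rhs => rw [← hp.map_eq]
    rw [integral_map hp.measurable.aemeasurable hfm.aestronglyMeasurable]
  have hS : Integrable (fun x' : Fin m → X => ∑ i, f (x' i)) (Measure.pi fun _ : Fin m => q) :=
    integrable_finsetSum _ fun i _ => hfi i
  have hg : Integrable g (Measure.pi fun _ : Fin m => q) :=
    (hS.sub (integrable_const _)).const_mul c
  have hgint : ∫ x', g x' ∂(Measure.pi fun _ : Fin m => q) =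
      c * (m * (∫ a, f a ∂q) - ∑ i, f (x i)) := by
    rw [integral_const_mul, integral_sub hS (integrable_const _),
      integral_finsetSum _ fun i _ => hfi i]
    simp [hfe]
  have hgm : Measurable g := by fun_prop
  have hgle (x' : Fin m → X) :
      g x' ≤ c * |∑ i, boolSign true * (f (x i) - f (x' i))| := by
    refine mul_le_mul_of_nonneg_left ?_ hc
    simp only [boolSign, if_true, one_mul, Finset.sum_sub_distrib]
    rw [abs_sub_comm]
    exact le_abs_self _
  have hexp : Integrable (Real.exp ∘ g) (Measure.pi fun _ : Fin m => q) := by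
    refine Integrable.of_bound (Real.measurable_exp.comp hgm).aestronglyMeasurable
      (Real.exp (c * m)) (ae_of_all _ fun x' => ?_)
    rw [Function.comp, Real.norm_eq_abs, abs_of_pos (Real.exp_pos _)]
    refine Real.exp_le_exp.2 ((hgle x').trans (mul_le_mul_of_nonneg_left ?_ hc))
    exact abs_signed_sum_le hF (fun _ => true) (fun i => (x i, x' i)) hf
  have hjensen := convexOn_exp.map_integral_le (μ := Measure.pi fun _ : Fin m => q)
    Real.continuous_exp.continuousOn isClosed_univ (ae_of_all _ fun x' => Set.mem_univ (g x'))
    hg hexp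
  rw [hgint] at hjensen
  refine (ENNReal.ofReal_le_ofReal hjensen).trans ?_
  rw [← Function.comp_def Real.exp g,
    ofReal_integral_eq_lintegral_ofReal hexp (ae_of_all _ fun x' => (Real.exp_pos _).le)]
  refine lintegral_mono fun x' => ENNReal.ofReal_le_ofReal (Real.exp_le_exp.2 ?_)
  refine (hgle x').trans (mul_le_mul_of_nonneg_left ?_ hc)
  exact le_signedSup hF (fun _ => true) (fun i => (x i, x' i)) hf

/-- Uniform one-sided deviation bound obtained from an exponential moment. -/
theorem exists_deviation_set {m N : ℕ} {F : Set (X → ℝ)} (hFne : F.Nonempty)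
    (hF : ∀ f ∈ F, ∀ x, f x ∈ Set.Icc (0 : ℝ) 1) (hFm : ∀ f ∈ F, Measurable f)
    (hfin : ∀ x : Fin (m + m) → X, (restrictions F x).Finite)
    (hN : ∀ x : Fin (m + m) → X, (restrictions F x).ncard ≤ N)
    (hFq : IsMeasurableClass q F) {c : ℝ} (hc : 0 < c) (t : ℝ) :
    ∃ B : Set (Fin m → X), MeasurableSet B ∧
      (Measure.pi fun _ : Fin m => q) B
        ≤ ENNReal.ofReal (2 * N * Real.exp (m * (c ^ 2 / 2) - c * t)) ∧
      ∀ x ∉ B, ∀ f ∈ F, m * (∫ a, f a ∂q) ≤ ∑ i, f (x i) + t := by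
  let W : (Fin m → X) × (Fin m → X) → ℝ≥0∞ := fun p => ENNReal.ofReal
    (Real.exp (c * signedSup F (fun _ => true) fun i => (p.1 i, p.2 i)))
  let Z : (Fin m → X) → ℝ≥0∞ := fun x => ∫⁻ x', W (x, x') ∂(Measure.pi fun _ : Fin m => q)
  have hpair := (measurePreserving_arrowProdEquivProdArrow X X (Fin m)
    (fun _ => q) (fun _ => q)).symm
  have hW : AEMeasurable W ((Measure.pi fun _ : Fin m => q).prod (Measure.pi fun _ : Fin m => q)) :=
    ((Real.measurable_exp.comp_aemeasurable
      ((aemeasurable_signedSup q hFq fun _ => true).const_mul c)).ennreal_ofReal).comp_quasiMeasurePreserving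
        hpair.quasiMeasurePreserving
  have hZ : AEMeasurable Z (Measure.pi fun _ : Fin m => q) := hW.lintegral_prod_right'
  have hZint : ∫⁻ x, Z x ∂(Measure.pi fun _ : Fin m => q)
      ≤ ENNReal.ofReal (2 * N * Real.exp (m * (c ^ 2 / 2))) := by
    rw [← lintegral_prod W hW]
    refine le_trans (le_of_eq ?_) (lintegral_exp_signedSup_le q hFne hF hfin hN hFq c)
    rw [← hpair.map_eq, lintegral_map_equiv]
    rfl
  -- Markov's inequality for `Z`, which dominates every `f` at once. As `Z` is only a.e. measurable,
  -- its superlevel set is replaced by a measurable hull of equal measure.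
  refine ⟨toMeasurable (Measure.pi fun _ => q) {x | ENNReal.ofReal (Real.exp (c * t)) ≤ Z x},
    measurableSet_toMeasurable _ _, ?_, fun x hx f hf => ?_⟩
  · rw [measure_toMeasurable]
    refine (meas_ge_le_lintegral_div hZ (by simp [Real.exp_pos]) ENNReal.ofReal_ne_top).trans ?_
    rw [Real.exp_sub, ← mul_div_assoc, ENNReal.ofReal_div_of_pos (Real.exp_pos _)]
    gcongr
  · by_contra! hlt
    refine hx (subset_toMeasurable _ _ ?_)
    refine le_trans (ENNReal.ofReal_le_ofReal (Real.exp_le_exp.2 ?_))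
      (exp_deviation_le_lintegral q hF hFm hc.le hf x)
    exact mul_le_mul_of_nonneg_left (by linarith) hc.le

end Symmetrization

/-! ### Restrictions of binary classes and their loss classes. -/

section GrowthFunction

variable {X : Type*} {H : Set (X → ℝ)}

theorem restrictions_subset_pi_pair (hH : ∀ h ∈ H, ∀ x, h x = 0 ∨ h x = 1) {m : ℕ}
    (x : Fin m → X) : restrictions H x ⊆ Set.univ.pi fun _ => ({0, 1} : Set ℝ) := by
  rintro _ ⟨h, hh, rfl⟩ i _
  exact hH h hh (x i)

theorem finite_pi_pair (m : ℕ) : (Set.univ.pi fun _ : Fin m => ({0, 1} : Set ℝ)).Finite :=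
  Set.Finite.pi fun _ => Set.toFinite _

theorem finite_restrictions (hH : ∀ h ∈ H, ∀ x, h x = 0 ∨ h x = 1) {m : ℕ} (x : Fin m → X) :
    (restrictions H x).Finite :=
  (finite_pi_pair m).subset (restrictions_subset_pi_pair hH x)

/-- Binary values matter here: `ncard` of an infinite set and an unbounded supremum in `ℕ` both
default to `0`. -/
theorem ncard_restrictions_le_growthFunction (hH : ∀ h ∈ H, ∀ x, h x = 0 ∨ h x = 1) {m : ℕ}
    (x : Fin m → X) : (restrictions H x).ncard ≤ growthFunction H m := by
  refine le_ciSup (f := fun x : Fin m → X => (restrictions H x).ncard) ?_ x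
  refine ⟨(Set.univ.pi fun _ : Fin m => ({0, 1} : Set ℝ)).ncard, ?_⟩
  rintro _ ⟨x, rfl⟩
  exact Set.ncard_le_ncard (restrictions_subset_pi_pair hH x) (finite_pi_pair m)

theorem one_le_growthFunction [Nonempty X] (hne : H.Nonempty)
    (hH : ∀ h ∈ H, ∀ x, h x = 0 ∨ h x = 1) (m : ℕ) : 1 ≤ growthFunction H m := by
  obtain ⟨a⟩ := ‹Nonempty X›
  refine le_trans ?_ (ncard_restrictions_le_growthFunction hH fun _ : Fin m => a)
  exact (Set.ncard_pos (finite_restrictions hH _)).2 (hne.image _)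

/-- Loss restrictions are an image of those of `H`, hence no more numerous. -/
theorem restrictions_lossClass (y : X → ℝ) {m : ℕ} (x : Fin m → X) :
    restrictions (lossClass H y) x =
      (fun (v : Fin m → ℝ) i => |v i - y (x i)|) '' restrictions H x := by
  simp only [restrictions, lossClass, Set.image_image]

theorem lossClass_mem_Icc {y : X → ℝ} (hy : ∀ x, y x ∈ Set.Icc (0 : ℝ) 1)
    (hH : ∀ h ∈ H, ∀ x, h x = 0 ∨ h x = 1) :
    ∀ f ∈ lossClass H y, ∀ x, f x ∈ Set.Icc (0 : ℝ) 1 := by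
  rintro _ ⟨h, hh, rfl⟩ x
  refine ⟨abs_nonneg _, ?_⟩
  have := hy x
  rw [abs_le]
  rcases hH h hh x with h0 | h0 <;> rw [h0] <;> constructor <;> linarith [this.1, this.2]

end GrowthFunction

/-! ### The ensemble loss against the average of the local losses. -/

theorem proportion_nonneg {K : ℕ} (n : Fin K → ℕ) (k : Fin K) : 0 ≤ proportion n k := by
  unfold proportion
  positivity

theorem weighted_ensemble_deviation_le {X : Type*} {K : ℕ} (n : Fin K → ℕ) {ρ : Fin K → X → ℝ}
    (hρ0 : ∀ k x, 0 ≤ ρ k x) (y : X → ℝ) (h : Fin K → X → ℝ) (x : X) :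
    (∑ k, proportion n k * ρ k x) * |ensemble (optimalWeight n ρ) h x - y x| ≤
      ∑ k, proportion n k * (ρ k x * |h k x - y x|) := by
  have hnn (k : Fin K) : 0 ≤ proportion n k * ρ k x := mul_nonneg (proportion_nonneg n k) (hρ0 k x)
  set r := ∑ k, proportion n k * ρ k x with hr
  have hr0 : 0 ≤ r := Finset.sum_nonneg fun k _ => hnn k
  rcases hr0.eq_or_lt with h0 | hpos
  -- Where the mixture density vanishes the weights are junk, but the left side is zero.
  · rw [← h0, zero_mul]
    exact Finset.sum_nonneg fun k _ =>
      mul_nonneg (proportion_nonneg n k) (mul_nonneg (hρ0 k x) (abs_nonneg _))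
  · have key : r * (ensemble (optimalWeight n ρ) h x - y x) =
        ∑ k, proportion n k * ρ k x * (h k x - y x) := by
      simp only [mul_sub, Finset.sum_sub_distrib, ← Finset.sum_mul, ← hr]
      congr 1
      unfold ensemble optimalWeight
      rw [Finset.mul_sum]
      refine Finset.sum_congr rfl fun k _ => ?_
      rw [← hr]
      field_simp
    calc r * |ensemble (optimalWeight n ρ) h x - y x|
        = |r * (ensemble (optimalWeight n ρ) h x - y x)| := by rw [abs_mul, abs_of_pos hpos]
      _ ≤ ∑ k, |proportion n k * ρ k x * (h k x - y x)| := by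
          rw [key]
          exact Finset.abs_sum_le_sum_abs _ _
      _ = _ := Finset.sum_congr rfl fun k _ => by rw [abs_mul, abs_of_nonneg (hnn k), mul_assoc]

section Loss

variable {X : Type*} [MeasurableSpace X]

theorem loss_empiricalMeasure {y h : X → ℝ} (hy : Measurable y) (hh : Measurable h) {m : ℕ}
    (s : Fin m → X) :
    loss (empiricalMeasure s) y h = (m : ℝ)⁻¹ * ∑ i, |h (s i) - y (s i)| := by
  have hm : Measurable fun x => |h x - y x| := by fun_prop
  unfold loss empiricalMeasure
  rw [integral_smul_measure, integral_finsetSum_measure]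
  · simp [integral_dirac' _ _ hm.stronglyMeasurable]
  · exact fun i _ => integrable_dirac' hm.stronglyMeasurable (by simp)

theorem integrable_empiricalMeasure {f : X → ℝ} (hf : Measurable f) {m : ℕ} (hm : 1 ≤ m)
    (s : Fin m → X) : Integrable f (empiricalMeasure s) := by
  unfold empiricalMeasure
  refine Integrable.smul_measure ?_ (by simp; omega)
  rw [integrable_finsetSum_measure]
  exact fun i _ => integrable_dirac' hf.stronglyMeasurable (by simp)

theorem loss_mixture {K : ℕ} (n : Fin K → ℕ) (q : Fin K → Measure X) {y h : X → ℝ}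
    (hint : ∀ k, Integrable (fun x => |h x - y x|) (q k)) :
    loss (mixture n q) y h = ∑ k, proportion n k * loss (q k) y h := by
  unfold loss mixture
  rw [integral_finsetSum_measure fun k _ => (hint k).smul_measure ENNReal.ofReal_ne_top]
  refine Finset.sum_congr rfl fun k _ => ?_
  rw [integral_smul_measure, ENNReal.toReal_ofReal (proportion_nonneg n k), smul_eq_mul]

theorem integral_densityMeasure (ν : Measure X) {ρ : X → ℝ} (hρ : Measurable ρ)
    (hρ0 : ∀ x, 0 ≤ ρ x) (g : X → ℝ) :
    ∫ x, g x ∂(densityMeasure ν ρ) = ∫ x, ρ x * g x ∂ν := by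
  unfold densityMeasure
  rw [integral_withDensity_eq_integral_toReal_smul hρ.ennreal_ofReal
    (ae_of_all _ fun _ => ENNReal.ofReal_lt_top)]
  simp [ENNReal.toReal_ofReal (hρ0 _)]

/-- The density of the mixture is exactly the denominator of `optimalWeight`, which is why it
cancels in the ensemble loss. -/
theorem mixture_densityMeasure (ν : Measure X) {K : ℕ} (n : Fin K → ℕ) {ρ : Fin K → X → ℝ}
    (hρ : ∀ k, Measurable (ρ k)) (hρ0 : ∀ k x, 0 ≤ ρ k x) :
    (mixture n fun k => densityMeasure ν (ρ k)) =
      densityMeasure ν fun x => ∑ k, proportion n k * ρ k x := by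
  unfold mixture densityMeasure
  simp_rw [← withDensity_smul _ (hρ _).ennreal_ofReal]
  ext s hs
  rw [Measure.finsetSum_apply, withDensity_apply _ hs]
  simp_rw [withDensity_apply _ hs]
  rw [← lintegral_finsetSum _ fun k _ => (hρ k).ennreal_ofReal.const_smul _]
  refine lintegral_congr fun x => ?_
  rw [ENNReal.ofReal_sum_of_nonneg fun k _ => mul_nonneg (proportion_nonneg n k) (hρ0 k x)]
  simp [ENNReal.ofReal_mul (proportion_nonneg n _)]

/-- The ensemble with the optimal weights loses at most the average of the local losses. -/
theorem loss_ensemble_le (ν : Measure X) {K : ℕ} (n : Fin K → ℕ) {ρ : Fin K → X → ℝ}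
    (hρ : ∀ k, Measurable (ρ k)) (hρ0 : ∀ k x, 0 ≤ ρ k x) {y : X → ℝ} {h : Fin K → X → ℝ}
    (hint : ∀ k, Integrable (fun x => |h k x - y x|) (densityMeasure ν (ρ k))) :
    loss (mixture n fun k => densityMeasure ν (ρ k)) y (ensemble (optimalWeight n ρ) h) ≤
      ∑ k, proportion n k * loss (densityMeasure ν (ρ k)) y (h k) := by
  have hint' (k : Fin K) : Integrable (fun x => ρ k x * |h k x - y x|) ν := by
    have := (integrable_withDensity_iff_integrable_smul' (hρ k).ennreal_ofReal
      (ae_of_all _ fun _ => ENNReal.ofReal_lt_top)).1 (hint k)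
    simpa [ENNReal.toReal_ofReal (hρ0 k _)] using this
  unfold loss
  rw [mixture_densityMeasure ν n hρ hρ0, integral_densityMeasure ν (by fun_prop)
    fun x => Finset.sum_nonneg fun k _ => mul_nonneg (proportion_nonneg n k) (hρ0 k x)]
  simp_rw [integral_densityMeasure ν (hρ _) (hρ0 _), ← integral_const_mul]
  rw [← integral_finsetSum _ fun k _ => (hint' k).const_mul _]
  refine integral_mono_of_nonneg (ae_of_all _ fun x => mul_nonneg
      (Finset.sum_nonneg fun k _ => mul_nonneg (proportion_nonneg n k) (hρ0 k x)) (abs_nonneg _))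
    (integrable_finsetSum _ fun k _ => (hint' k).const_mul _)
    (ae_of_all _ fun x => weighted_ensemble_deviation_le n hρ0 y h x)

end Loss

/-! ### Uniform convergence at the stated rate. -/

section UniformBound

/-- The exponent is `-m ε² / 2 = -(4 + L)² / (4 η²)`, with `L² = log N`. As `4 η² ≤ 1`, it is at
most `-log N - 4 / η²`: the first term absorbs the factor `N`, and the second leaves at most `η² / 2
≤ η`. -/
theorem two_mul_exp_deviation_le {N m : ℕ} (hN : 1 ≤ N) (hm : 1 ≤ m) {η : ℝ} (hη : 0 < η)
    (hη2 : η ≤ 1 / 2) {ε : ℝ} (hε : ε = (4 + √(Real.log N)) / (η * √(2 * (m : ℝ)))) :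
    2 * N * Real.exp (m * (ε ^ 2 / 2) - ε * (m * ε)) ≤ η := by
  set L := √(Real.log N) with hL
  have hL0 : 0 ≤ L := Real.sqrt_nonneg _
  have hLsq : L ^ 2 = Real.log N := Real.sq_sqrt (Real.log_natCast_nonneg N)
  have hNpos : (0 : ℝ) < N := by exact_mod_cast hN
  have hmpos : (0 : ℝ) < m := by exact_mod_cast hm
  have hexpo : m * (ε ^ 2 / 2) - ε * (m * ε) = -((4 + L) ^ 2 / (4 * η ^ 2)) := by
    have hsq : √(2 * (m : ℝ)) ^ 2 = 2 * m := Real.sq_sqrt (by positivity)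
    have : ε ^ 2 = (4 + L) ^ 2 / (η ^ 2 * (2 * m)) := by rw [hε, div_pow, mul_pow, hsq]
    have h2 : m * (ε ^ 2 / 2) - ε * (m * ε) = -(m * ε ^ 2 / 2) := by ring
    rw [h2, this]
    field_simp
    ring
  have hbound : L ^ 2 + 4 / η ^ 2 ≤ (4 + L) ^ 2 / (4 * η ^ 2) := by
    have hη4 : 4 * η ^ 2 ≤ 1 := by nlinarith
    rw [le_div_iff₀ (by positivity)]
    have : (L ^ 2 + 4 / η ^ 2) * (4 * η ^ 2) = L ^ 2 * (4 * η ^ 2) + 16 := by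
      field_simp
      ring
    rw [this]
    nlinarith [mul_le_mul_of_nonneg_left hη4 (sq_nonneg L)]
  have hexp1 : Real.exp (-(4 / η ^ 2)) ≤ η ^ 2 / 4 := by
    rw [Real.exp_neg, inv_le_comm₀ (Real.exp_pos _) (by positivity), inv_div]
    linarith [Real.add_one_le_exp (4 / η ^ 2)]
  calc 2 * N * Real.exp (m * (ε ^ 2 / 2) - ε * (m * ε))
      ≤ 2 * N * Real.exp (-Real.log N + -(4 / η ^ 2)) := by
        rw [hexpo]
        gcongr
        linarith
    _ = 2 * Real.exp (-(4 / η ^ 2)) := by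
        rw [Real.exp_add, Real.exp_neg, Real.exp_log hNpos]
        field_simp
    _ ≤ η := by nlinarith

variable {X : Type*} [MeasurableSpace X]

/-- Uniform convergence of the empirical losses of a binary class, in terms of the growth
function. -/
theorem exists_loss_deviation_set (q : Measure X) [IsProbabilityMeasure q]
    {y : X → ℝ} (hym : Measurable y) (hy : ∀ x, y x ∈ Set.Icc (0 : ℝ) 1)
    {H : Set (X → ℝ)} (hHne : H.Nonempty) (hHm : ∀ h ∈ H, Measurable h)
    (hH : ∀ h ∈ H, ∀ x, h x = 0 ∨ h x = 1) (hHq : IsMeasurableClass q (lossClass H y))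
    {m : ℕ} (hm : 1 ≤ m) {η : ℝ} (hη : 0 < η) (hη2 : η ≤ 1 / 2) :
    ∃ B : Set (Fin m → X), MeasurableSet B ∧
      (Measure.pi fun _ : Fin m => q) B ≤ ENNReal.ofReal η ∧
      ∀ x ∉ B, ∀ h ∈ H, loss q y h ≤ loss (empiricalMeasure x) y h +
        (4 + √(Real.log (growthFunction H (2 * m)))) / (η * √(2 * (m : ℝ))) := by
  have : Nonempty X := nonempty_of_isProbabilityMeasure q
  have hmpos : (0 : ℝ) < m := by exact_mod_cast hm
  set ε := (4 + √(Real.log (growthFunction H (2 * m)))) / (η * √(2 * (m : ℝ))) with hε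
  have hεpos : 0 < ε := by positivity
  have hfin (x : Fin (m + m) → X) : (restrictions (lossClass H y) x).Finite := by
    rw [restrictions_lossClass]
    exact (finite_restrictions hH x).image _
  have hcard (x : Fin (m + m) → X) :
      (restrictions (lossClass H y) x).ncard ≤ growthFunction H (2 * m) := by
    rw [restrictions_lossClass, two_mul]
    exact (Set.ncard_image_le (finite_restrictions hH x)).trans
      (ncard_restrictions_le_growthFunction hH x)
  have hFm : ∀ f ∈ lossClass H y, Measurable f := by
    rintro _ ⟨h, hh, rfl⟩
    have := hHm h hh
    fun_prop
  -- For the threshold `t = m ε`, the choice `c = ε` minimises `m c² / 2 - c t`.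
  obtain ⟨B, hB, hBle, hBdev⟩ := exists_deviation_set q (hHne.image _)
    (lossClass_mem_Icc hy hH) hFm hfin hcard hHq hεpos (m * ε)
  refine ⟨B, hB, hBle.trans (ENNReal.ofReal_le_ofReal
    (two_mul_exp_deviation_le (one_le_growthFunction hHne hH _) hm hη hη2 hε)),
    fun x hx h hh => ?_⟩
  have h1 := hBdev x hx _ ⟨h, hh, rfl⟩
  rw [loss_empiricalMeasure hym (hHm h hh), loss, ← mul_le_mul_iff_right₀ hmpos, mul_add,
    mul_inv_cancel_left₀ hmpos.ne']
  exact h1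

end UniformBound

/-! ### Union bound over the clients and conclusion. -/

theorem theoremC1
    {X : Type*} [MeasurableSpace X]
    -- number of clients, sample sizes
    (K : ℕ) (n : Fin K → ℕ) (hn : ∀ k, 1 ≤ n k)
    -- the clients' distributions, given by densities
    (ν : Measure X) (ρ : Fin K → X → ℝ) (hρ_meas : ∀ k, Measurable (ρ k))
    (hρ_nonneg : ∀ k x, 0 ≤ ρ k x) (hρ_one : ∀ k, ∫⁻ x, ENNReal.ofReal (ρ k x) ∂ν = 1)
    -- labeling function and hypothesis class
    (y : X → ℝ) (hy_meas : Measurable y) (hy : ∀ x, y x ∈ Set.Icc (0 : ℝ) 1)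
    (H : Set (X → ℝ)) (hH_meas : ∀ h ∈ H, Measurable h)
    (hH_bin : ∀ h ∈ H, ∀ x, h x = 0 ∨ h x = 1)
    (hH_class : ∀ k, IsMeasurableClass (densityMeasure ν (ρ k)) (lossClass H y))
    -- the samples: for each client `k`, `n k` i.i.d. points
    {Ω : Type*} [MeasurableSpace Ω] (P : Measure Ω) [IsProbabilityMeasure P]
    (S : (k : Fin K) → Fin (n k) → Ω → X) (hS_meas : ∀ k i, Measurable (S k i))
    (hS_law : ∀ k i, P.map (S k i) = densityMeasure ν (ρ k))
    (hS_indep : ∀ k, iIndepFun (S k) P)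
    -- confidence level
    (δ : ℝ) (hδ_pos : 0 < δ) (hδ_lt : δ < 1) (hδK : δ ≤ (K : ℝ) / 2) :
    ∃ E : Set Ω, MeasurableSet E ∧ 1 - δ ≤ P.real E ∧ ∀ ω ∈ E,
      ∀ h : Fin K → X → ℝ,
        (∀ k, IsLossMinimizer H y (empiricalMeasure fun i => S k i ω) (h k)) →
        loss (mixture n fun k => densityMeasure ν (ρ k)) y (ensemble (optimalWeight n ρ) h)
            ≤ ∑ k, proportion n k *
                (loss (empiricalMeasure fun i => S k i ω) y (h k) +
                  (4 + √(Real.log (growthFunction H (2 * n k)))) /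
                    ((δ / K) * √(2 * (n k : ℝ)))) ∧
        ∀ g : X → ℝ,
          IsLossMinimizer H y (mixture n fun k => empiricalMeasure fun i => S k i ω) g →
          ∑ k, proportion n k *
                (loss (empiricalMeasure fun i => S k i ω) y (h k) +
                  (4 + √(Real.log (growthFunction H (2 * n k)))) /
                    ((δ / K) * √(2 * (n k : ℝ))))
            ≤ loss (mixture n fun k => empiricalMeasure fun i => S k i ω) y g +
                ∑ k, proportion n k *
                  ((4 + √(Real.log (growthFunction H (2 * n k)))) /
                    ((δ / K) * √(2 * (n k : ℝ)))) := by
  -- An empty class has no minimizers, and `δ ≤ K / 2` forces `K > 0`, so the claim is vacuous.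
  rcases H.eq_empty_or_nonempty with rfl | hHne
  · have hK : 0 < K := by
      rcases Nat.eq_zero_or_pos K with rfl | hK
      · norm_num at hδK
        linarith
      · exact hK
    refine ⟨Set.univ, MeasurableSet.univ, ?_, fun ω _ h hh => absurd (hh ⟨0, hK⟩).1 (by simp)⟩
    rw [probReal_univ]
    linarith
  have hKpos : (0 : ℝ) < K := by linarith
  have hq (k : Fin K) : IsProbabilityMeasure (densityMeasure ν (ρ k)) :=
    ⟨by simpa [densityMeasure] using hρ_one k⟩
  have hη : 0 < δ / K := by positivity
  have hη2 : δ / K ≤ 1 / 2 := by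
    rw [div_le_iff₀ hKpos]
    linarith
  choose B hBm hBle hBdev using fun k => exists_loss_deviation_set (densityMeasure ν (ρ k))
    hy_meas hy hHne hH_meas hH_bin (hH_class k) (hn k) hη hη2
  have hSm (k : Fin K) : Measurable fun ω i => S k i ω :=
    measurable_pi_lambda _ fun i => hS_meas k i
  have hlaw (k : Fin K) : P.map (fun ω i => S k i ω) =
      Measure.pi fun _ => densityMeasure ν (ρ k) := by
    rw [(iIndepFun_iff_map_fun_eq_pi_map fun i => (hS_meas k i).aemeasurable).1 (hS_indep k)]
    simp_rw [hS_law]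
  -- Each client fails with probability at most `δ / K`; the union bound needs no independence
  -- between clients.
  let bad : Set Ω := ⋃ k, (fun ω i => S k i ω) ⁻¹' B k
  have hbad : MeasurableSet bad := MeasurableSet.iUnion fun k => hSm k (hBm k)
  have hbadle : P.real bad ≤ δ := by
    refine (measureReal_iUnion_fintype_le _).trans ?_
    calc _ ≤ ∑ _k : Fin K, δ / K := by
          refine Finset.sum_le_sum fun k _ => ?_
          refine ENNReal.toReal_le_of_le_ofReal hη.le ?_
          rw [← Measure.map_apply (hSm k) (hBm k), hlaw k]
          exact hBle k
      _ = δ := by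
          rw [Finset.sum_const, Finset.card_univ, Fintype.card_fin, nsmul_eq_mul]
          field_simp
  refine ⟨badᶜ, hbad.compl, ?_, fun ω hω h hh => ⟨?_, fun g hg => ?_⟩⟩
  · rw [probReal_compl_eq_one_sub hbad]
    linarith
  · have hloss (k : Fin K) : Integrable (fun x => |h k x - y x|) (densityMeasure ν (ρ k)) := by
      have hm := hH_meas _ (hh k).1
      refine Integrable.of_bound (by fun_prop) 1 (ae_of_all _ fun x => ?_)
      rw [Real.norm_eq_abs, abs_abs]
      exact (lossClass_mem_Icc hy hH_bin _ ⟨h k, (hh k).1, rfl⟩ x).2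
    refine (loss_ensemble_le ν n hρ_meas hρ_nonneg hloss).trans ?_
    refine Finset.sum_le_sum fun k _ => mul_le_mul_of_nonneg_left ?_ (proportion_nonneg n k)
    exact hBdev k _ (fun hk => hω (Set.mem_iUnion.2 ⟨k, hk⟩)) _ (hh k).1
  · have hgm := hH_meas g hg.1
    -- By linearity the loss of `g` splits over the clients, where each `h k` does at least as well
    -- as `g`.
    rw [loss_mixture n _ fun k => integrable_empiricalMeasure (by fun_prop) (hn k) _,
      ← Finset.sum_add_distrib]
    refine Finset.sum_le_sum fun k _ => ?_
    rw [mul_add]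
    gcongr
    · exact proportion_nonneg n k
    · exact (hh k).2 g hg.1
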